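/- Let $n,m,s\ge 0$, let $\mathbf{x}=x_1,\dots,x_n$ and $\mathbf{u}=u_1,\dots,u_m$ be variables, and let $\mathbf{f}=f_1,\dots,f_n$ and $\mathbf{g}=g_1,\dots,g_s$ be polynomials in $\mathbb{C}[\mathbf{x},\mathbf{u}]$. Put $$\widetilde g_i:=\sum_{j=1}^n\frac{\partial g_i}{\partial x_j}\,f_j+\sum_{k=1}^m\frac{\partial g_i}{\partial u_k}\,\dot u_k\in\mathbb{C}[\mathbf{x},\mathbf{u},\dot{\mathbf{u}}]\qquad(1\le i\le s),$$ where $\dot{\mathbf{u}}=\dot u_1,\dots,\dot u_m$ are new variables. Let $V(\mathbf{g})\subseteq\mathbb{C}^{n+m}$ and $V(\mathbf{g},\widetilde{\mathbf{g}})\subseteq\mathbb{C}^{n+2m}$ be the sets of common zeros, and let $\pi:\mathbb{C}^{n+2m}\to\mathbb{C}^{n+m}$ be the projection $(\mathbf{x},\mathbf{u},\dot{\mathbf{u}})\mapsto(\mathbf{x},\mathbf{u})$. Closures, irreducible components and dimensions refer to the Zariski topology. Suppose that the ideal $(\mathbf{g})\subseteq\mathbb{C}[\mathbf{x},\mathbf{u}]$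 is radical and that the differential system $$\dot{\mathbf{x}}=\mathbf{f}(\mathbf{x},\mathbf{u}),\qquad \mathbf{g}(\mathbf{x},\mathbf{u})=0$$ has no solution, that is, no solution $(\mathbf{x},\mathbf{u})\in K^{n+m}$ in any differential field extension $K$ of $\mathbb{C}$ (where $\mathbb{C}$ carries the zero derivation). Then no irreducible component of $V(\mathbf{g})$ is contained in the Zariski closure $\overline{\pi(V(\mathbf{g},\widetilde{\mathbf{g}}))}$. Moreover $\pi(V(\mathbf{g},\widetilde{\mathbf{g}}))\subseteq V(\mathbf{g})$ and, if $V(\mathbf{g})\neq\emptyset$, $$\dim\overline{\pi(V(\mathbf{g},\widetilde{\mathbf{g}}))}<\dim V(\mathbf{g}).$$ -/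

import Mathlib

noncomputable section

namespace SemiexplicitDAE

/-- The affine space `ℂ^σ`, regarded with its Zariski topology (see the instance below). -/
def ZariskiSpace (σ : Type) : Type := σ → ℂ

/-- The affine variety `V(S)`: the set of common zeros in `ℂ^σ` of a set `S` of polynomials. -/
def variety {σ : Type} (S : Set (MvPolynomial σ ℂ)) : Set (ZariskiSpace σ) :=
  {a | ∀ p ∈ S, MvPolynomial.eval a p = 0}

/-- The Zariski topology: the closed sets are exactly the affine varieties `V(S)`. -/
instance instTopologicalSpaceZariskiSpace (σ : Type) : TopologicalSpace (ZariskiSpace σ) :=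
  TopologicalSpace.ofClosed {Z | ∃ S : Set (MvPolynomial σ ℂ), Z = variety S}
    ⟨{1}, by
      ext a
      simp [variety]⟩
    (by
      intro A hA
      refine ⟨{p | ∃ S : Set (MvPolynomial σ ℂ), variety S ∈ A ∧ p ∈ S}, ?_⟩
      ext a
      constructor
      · rintro ha p ⟨S, hS, hp⟩
        exact ha _ hS p hp
      · intro ha Z hZ
        obtain ⟨S, rfl⟩ := hA hZ
        exact fun p hp => ha p ⟨S, hZ, hp⟩)
    (by
      rintro _ ⟨S, rfl⟩ _ ⟨T, rfl⟩
      refine ⟨{r | ∃ p ∈ S, ∃ q ∈ T, r = p * q}, ?_⟩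
      ext a
      constructor
      · rintro (h | h) r ⟨p, hp, q, hq, rfl⟩
        · simp [h p hp]
        · simp [h q hq]
      · intro h
        by_cases hS : a ∈ variety S
        · exact Or.inl hS
        · right
          have hS' : ∃ p ∈ S, MvPolynomial.eval a p ≠ 0 := by
            by_contra hc
            exact hS fun p hp => by_contra fun h0 => hc ⟨p, hp, h0⟩
          obtain ⟨p, hp, hpa⟩ := hS'
          intro q hq
          have hpq := h (p * q) ⟨p, hp, q, hq, rfl⟩
          rw [map_mul] at hpq
          exact (mul_eq_zero.mp hpq).resolve_left hpa)

theorem isClosed_iff {σ : Type} (Z : Set (ZariskiSpace σ)) :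
    IsClosed Z ↔ ∃ S : Set (MvPolynomial σ ℂ), Z = variety S := by
  rw [← isOpen_compl_iff]
  change Zᶜᶜ ∈ {Z | ∃ S : Set (MvPolynomial σ ℂ), Z = variety S} ↔ _
  rw [compl_compl]
  rfl

/-- `C` is an irreducible component of the subset `V`: a maximal irreducible subset of `V`
(irreducible sets are nonempty by definition). -/
def IsIrreducibleComponentOf {X : Type} [TopologicalSpace X] (C V : Set X) : Prop :=
  Maximal (fun D : Set X => IsIrreducible D ∧ D ⊆ V) C

/-- The system `ẋ = f(x, u)`, `g(x, u) = 0` has a solution: there are a differential field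
extension `(K, δ)` of `ℂ` (where `ℂ` consists of constants, as `δ` is `ℂ`-linear) and elements
`ξ`, `υ` of `K` with `δ ξ = f(ξ, υ)` and `g(ξ, υ) = 0`.
The variables `x` are indexed by `Sum.inl`, the variables `u` by `Sum.inr`. -/
def HasSolution {n m s : ℕ} (f : Fin n → MvPolynomial (Fin n ⊕ Fin m) ℂ)
    (g : Fin s → MvPolynomial (Fin n ⊕ Fin m) ℂ) : Prop :=
  ∃ (K : Type) (_ : Field K) (_ : Algebra ℂ K) (δ : Derivation ℂ K K)
    (ξ : Fin n → K) (υ : Fin m → K),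
    (∀ j, δ (ξ j) = MvPolynomial.aeval (Sum.elim ξ υ) (f j)) ∧
    ∀ i, MvPolynomial.aeval (Sum.elim ξ υ) (g i) = 0

/-- `h̃ = ∑ j, (∂h/∂x_j) f_j + ∑ k, (∂h/∂u_k) u̇_k` in `ℂ[x, u, u̇]`, where the variables `x, u`
are indexed by `Sum.inl` and the variables `u̇` by `Sum.inr`. -/
def tilde {n m : ℕ} (f : Fin n → MvPolynomial (Fin n ⊕ Fin m) ℂ)
    (h : MvPolynomial (Fin n ⊕ Fin m) ℂ) : MvPolynomial ((Fin n ⊕ Fin m) ⊕ Fin m) ℂ :=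
  (∑ j : Fin n, MvPolynomial.rename Sum.inl (MvPolynomial.pderiv (Sum.inl j) h * f j)) +
    ∑ k : Fin m, MvPolynomial.rename Sum.inl (MvPolynomial.pderiv (Sum.inr k) h) *
      MvPolynomial.X (Sum.inr k)

/-- The variety `V(g, g̃)` in `ℂ^(n+2m)`. -/
def prolongation {n m s : ℕ} (f : Fin n → MvPolynomial (Fin n ⊕ Fin m) ℂ)
    (g : Fin s → MvPolynomial (Fin n ⊕ Fin m) ℂ) : Set (ZariskiSpace ((Fin n ⊕ Fin m) ⊕ Fin m)) :=
  variety (Set.range (fun i => MvPolynomial.rename Sum.inl (g i)) ∪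
    Set.range (fun i => tilde f (g i)))

/-- The projection `π : ℂ^(n+2m) → ℂ^(n+m)`, `(x, u, u̇) ↦ (x, u)`. -/
def proj {n m : ℕ} (z : ZariskiSpace ((Fin n ⊕ Fin m) ⊕ Fin m)) : ZariskiSpace (Fin n ⊕ Fin m) :=
  fun v => z (Sum.inl v)

end SemiexplicitDAE

end

/-! Let `C` be a component, `P` its prime, `L` its function field and `ξ` its generic point. At `ξ`
the equations `g̃ = 0` form a linear system over `L` in the unknowns `u̇`. If it is solvable, `f(ξ)`
and the solution form a tangent vector annihilating `(g)`. A radical ideal agrees with `P` after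
localizing at `P`, so the vector annihilates `P` and defines a derivation of `L`, which solves the
differential system (`hasSolution_of_linear_solution`). If not, the Fredholm alternative eliminates
`u̇` and leaves a nonzero constant term. Clearing denominators gives a polynomial outside `P` that
vanishes on the projection (`eval_obstruction_eq_zero`), so `C` is not in its closure. The dimension
bound follows by extending a longest chain in the closure by a component. -/

noncomputable section

open MvPolynomial

namespace SemiexplicitDAE

/-! ### Components and Krull dimension of subspaces -/

section Topology

variable {X : Type} [TopologicalSpace X]

theorem isIrreducibleComponentOf_image_val {V : Set X} {u : Set V}
    (hu : u ∈ irreducibleComponents V) : IsIrreducibleComponentOf (Subtype.val '' u) V := by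
  refine ⟨⟨hu.1.image _ continuous_subtype_val.continuousOn, Subtype.coe_image_subset V u⟩, ?_⟩
  rintro D ⟨hD, hDV⟩ huD
  have himg : Subtype.val '' (Subtype.val ⁻¹' D : Set V) = D := by
    rw [Subtype.image_preimage_coe, Set.inter_eq_right.mpr hDV]
  have hirr : IsIrreducible (Subtype.val ⁻¹' D : Set V) := by
    refine ⟨?_, ?_⟩
    · obtain ⟨x, hx⟩ := hD.nonempty
      exact ⟨⟨x, hDV hx⟩, hx⟩
    · intro a b ha hb
      obtain ⟨a', ha', rfl⟩ := isOpen_induced_iff.mp ha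
      obtain ⟨b', hb', rfl⟩ := isOpen_induced_iff.mp hb
      rintro ⟨x, hx, hxa⟩ ⟨y, hy, hyb⟩
      obtain ⟨z, hz, hza⟩ := hD.2 a' b' ha' hb' ⟨x, hx, hxa⟩ ⟨y, hy, hyb⟩
      exact ⟨⟨z, hDV hz⟩, hz, hza⟩
  have := hu.2 hirr (Set.image_subset_iff.mp huD)
  rw [← himg]
  exact Set.image_mono this

theorem topologicalKrullDim_lt_of_forall_component {A V : Set X} (hA : IsClosed A) (hAV : A ⊆ V)
    (hV : V.Nonempty) (hfin : topologicalKrullDim V < ⊤)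
    (h : ∀ C, IsIrreducibleComponentOf C V → ¬ C ⊆ A) :
    topologicalKrullDim A < topologicalKrullDim V := by
  have hind : Topology.IsInducing (Set.inclusion hAV) :=
    (Topology.IsEmbedding.inclusion hAV).isInducing
  rcases A.eq_empty_or_nonempty with hAe | hAn
  · have : IsEmpty A := Set.isEmpty_coe_sort.mpr hAe
    have : IsEmpty (TopologicalSpace.IrreducibleCloseds A) :=
      ⟨fun Z => isEmptyElim Z.isIrreducible.nonempty.some⟩
    have : Nonempty (TopologicalSpace.IrreducibleCloseds V) := by
      obtain ⟨x, hx⟩ := hV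
      exact ⟨⟨_, isIrreducible_singleton (x := (⟨x, hx⟩ : V)).closure, isClosed_closure⟩⟩
    rw [topologicalKrullDim, Order.krullDim_eq_bot]
    exact Order.bot_lt_krullDim
  · have : Nonempty (TopologicalSpace.IrreducibleCloseds A) := by
      obtain ⟨x, hx⟩ := hAn
      exact ⟨⟨_, isIrreducible_singleton (x := (⟨x, hx⟩ : A)).closure, isClosed_closure⟩⟩
    have hfinA : topologicalKrullDim A < ⊤ := hind.topologicalKrullDim_le.trans_lt hfin
    have : FiniteDimensionalOrder (TopologicalSpace.IrreducibleCloseds A) :=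
      Order.finiteDimensionalOrder_iff_krullDim_ne_bot_and_top.mpr
        ⟨Order.krullDim_ne_bot_iff.mpr this, hfinA.ne⟩
    let l := LTSeries.longestOf (TopologicalSpace.IrreducibleCloseds A)
    let l' := l.map _ (TopologicalSpace.IrreducibleCloseds.map_strictMono_of_isInducing hind)
    obtain ⟨u, hu, hlu⟩ := exists_mem_irreducibleComponents_subset_of_isIrreducible
      (l'.last : Set V) l'.last.isIrreducible
    let U : TopologicalSpace.IrreducibleCloseds V :=
      ⟨u, hu.1, isClosed_of_mem_irreducibleComponents u hu⟩
    have hlt : l'.last < U := by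
      -- The pushed-forward chain stays inside the closed set `A`, whereas no component does; hence
      -- the component adds one more step.
      refine lt_of_le_of_ne hlu fun heq => h _ (isIrreducibleComponentOf_image_val hu) ?_
      have hcl : (l'.last : Set V) ⊆ Subtype.val ⁻¹' A := by
        rw [LTSeries.last_map]
        refine closure_minimal ?_ (hA.preimage continuous_subtype_val)
        rintro _ ⟨y, -, rfl⟩
        exact y.2
      rw [heq] at hcl
      exact Set.image_subset_iff.mpr hcl
    have hle := Order.LTSeries.length_le_krullDim (l'.snoc U hlt)
    rw [topologicalKrullDim, topologicalKrullDim,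
      Order.krullDim_eq_length_of_finiteDimensionalOrder]
    refine lt_of_lt_of_le ?_ hle
    simp only [RelSeries.snoc_length]
    exact_mod_cast Nat.lt_succ_self l.length

end Topology

/-! ### Varieties, prime ideals and finite dimension -/

section Zariski

variable {σ : Type}

theorem isClosed_variety (S : Set (MvPolynomial σ ℂ)) : IsClosed (variety S) :=
  (isClosed_iff _).mpr ⟨S, rfl⟩

/-- The ideal of polynomials vanishing on a subset of affine space. -/
def idealOf (Z : Set (ZariskiSpace σ)) : Ideal (MvPolynomial σ ℂ) :=
  vanishingIdeal ℂ (K := ℂ) (Z : Set (σ → ℂ))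

theorem variety_idealOf_of_isClosed {Z : Set (ZariskiSpace σ)} (hZ : IsClosed Z) :
    variety (idealOf Z : Set (MvPolynomial σ ℂ)) = Z := by
  obtain ⟨S, rfl⟩ := (isClosed_iff Z).mp hZ
  ext a
  exact ⟨fun ha p hp => ha p fun b hb => hb p hp, fun ha p hp => hp a ha⟩

theorem eval_eq_zero_of_mem_closure {A : Set (ZariskiSpace σ)} {p : MvPolynomial σ ℂ}
    (hp : ∀ a ∈ A, eval a p = 0) {a : ZariskiSpace σ} (ha : a ∈ closure A) : eval a p = 0 := by
  have : closure A ⊆ variety {p} := closure_minimal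
    (fun a ha q hq => by rw [Set.mem_singleton_iff.mp hq]; exact hp a ha) (isClosed_variety _)
  exact this ha p rfl

theorem variety_span (S : Set (MvPolynomial σ ℂ)) :
    variety (Ideal.span S : Set (MvPolynomial σ ℂ)) = variety S :=
  zeroLocus_span (K := ℂ) S

theorem isPrime_idealOf {Z : Set (ZariskiSpace σ)} (hZ : IsIrreducible Z) :
    (idealOf Z).IsPrime := by
  refine ⟨fun h => ?_, fun {p q} hpq => ?_⟩
  · obtain ⟨a, ha⟩ := hZ.nonempty
    have := (Ideal.eq_top_iff_one _).mp h a ha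
    simp at this
  · have := isPreirreducible_iff_isClosed_union_isClosed.mp hZ.2 (variety {p}) (variety {q})
      (isClosed_variety _) (isClosed_variety _) (fun a ha => by
        have h0 : eval a p * eval a q = 0 := by rw [← map_mul]; exact hpq a ha
        rcases mul_eq_zero.mp h0 with h | h
        · left; rintro _ rfl; exact h
        · right; rintro _ rfl; exact h)
    exact this.imp (fun h a ha => h ha p rfl) (fun h a ha => h ha q rfl)

/-- Hilbert's Nullstellensatz over `ℂ`. -/
theorem idealOf_variety_of_isPrime [Finite σ] (Q : Ideal (MvPolynomial σ ℂ)) [Q.IsPrime] :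
    idealOf (variety (Q : Set (MvPolynomial σ ℂ))) = Q :=
  IsPrime.vanishingIdeal_zeroLocus (K := ℂ) Q

theorem isIrreducible_variety_of_isPrime [Finite σ] (Q : Ideal (MvPolynomial σ ℂ))
    [hQ : Q.IsPrime] : IsIrreducible (variety (Q : Set (MvPolynomial σ ℂ))) := by
  have hI := idealOf_variety_of_isPrime Q
  refine ⟨?_, isPreirreducible_iff_isClosed_union_isClosed.mpr ?_⟩
  · by_contra hne
    rw [Set.not_nonempty_iff_eq_empty] at hne
    refine hQ.ne_top ?_
    rw [← hI, hne]
    exact vanishingIdeal_empty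
  · intro Z₁ Z₂ h₁ h₂ hsub
    obtain ⟨S, rfl⟩ := (isClosed_iff Z₁).mp h₁
    obtain ⟨T, rfl⟩ := (isClosed_iff Z₂).mp h₂
    by_contra! hcon
    obtain ⟨⟨a, ha, haS⟩, b, hb, hbT⟩ := And.intro (Set.not_subset.mp hcon.1)
      (Set.not_subset.mp hcon.2)
    simp only [variety, Set.mem_ofPred_eq, not_forall] at haS hbT
    obtain ⟨p, hpS, hpa⟩ := haS
    obtain ⟨q, hqT, hqb⟩ := hbT
    have hpq : p * q ∈ Q := by
      rw [← hI]
      intro c hc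
      change eval c (p * q) = 0
      rcases hsub hc with h | h
      · rw [map_mul, h p hpS, zero_mul]
      · rw [map_mul, h q hqT, mul_zero]
    rcases hQ.mem_or_mem hpq with h | h
    · exact hpa (ha p h)
    · exact hqb (hb q h)

theorem idealOf_mem_minimalPrimes [Finite σ] {S : Set (MvPolynomial σ ℂ)}
    {C : Set (ZariskiSpace σ)} (hC : IsIrreducibleComponentOf C (variety S)) :
    idealOf C ∈ (Ideal.span S).minimalPrimes := by
  refine ⟨⟨isPrime_idealOf hC.1.1, Ideal.span_le.mpr fun p hp a ha => hC.1.2 ha p hp⟩, ?_⟩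
  rintro Q ⟨hQ, hSQ⟩ hQC
  have hCQ : C ⊆ variety (Q : Set (MvPolynomial σ ℂ)) := fun a ha p hp => hQC hp a ha
  have hle := hC.2 ⟨isIrreducible_variety_of_isPrime Q,
    fun a ha p hp => ha p (hSQ (Ideal.subset_span hp))⟩ hCQ
  conv_rhs => rw [← idealOf_variety_of_isPrime Q]
  exact fun p hp a ha => hp a (hle ha)

/-- Vanishing ideals embed the irreducible closed sets, with order reversed, into the prime
spectrum. Finiteness guarantees a longest chain. -/
theorem topologicalKrullDim_zariskiSpace_lt_top [Finite σ] :
    topologicalKrullDim (ZariskiSpace σ) < ⊤ := by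
  have hle : topologicalKrullDim (ZariskiSpace σ) ≤ ringKrullDim (MvPolynomial σ ℂ) := by
    rw [topologicalKrullDim, ringKrullDim, ← Order.krullDim_orderDual]
    refine Order.krullDim_le_of_strictMono
      (fun Z => ⟨idealOf ((OrderDual.ofDual Z : TopologicalSpace.IrreducibleCloseds _) :
          Set (ZariskiSpace σ)),
        isPrime_idealOf (OrderDual.ofDual Z).isIrreducible⟩) ?_
    refine Monotone.strictMono_of_injective ?_ ?_
    · intro Z W h p hp a ha
      exact hp a (OrderDual.ofDual_le_ofDual.mpr h ha)
    · intro Z W h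
      have h' := congrArg PrimeSpectrum.asIdeal h
      refine OrderDual.ofDual.injective (TopologicalSpace.IrreducibleCloseds.ext ?_)
      rw [← variety_idealOf_of_isClosed (OrderDual.ofDual Z).isClosed,
        ← variety_idealOf_of_isClosed (OrderDual.ofDual W).isClosed]
      exact congrArg (fun I : Ideal (MvPolynomial σ ℂ) => variety (I : Set (MvPolynomial σ ℂ))) h'
  refine hle.trans_lt ?_
  rw [MvPolynomial.ringKrullDim_of_isNoetherianRing, ringKrullDim_eq_zero_of_field, zero_add]
  exact WithBot.coe_lt_coe.mpr (ENat.natCast_lt_top _)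

end Zariski

/-! ### Radical ideals localized at a minimal prime -/

section MinimalPrimes

variable {R : Type*} [CommRing R]

/-- Otherwise the monoid generated by `p` and the complement of `P` misses `I`, and a prime over `I`
disjoint from it would lie in `P` without containing `p`, against minimality. -/
theorem exists_mul_mem_of_mem_minimalPrimes {I P : Ideal R} (hI : I.IsRadical)
    (hP : P ∈ I.minimalPrimes) {p : R} (hp : p ∈ P) : ∃ h ∉ P, h * p ∈ I := by
  have hprime : P.IsPrime := hP.1.1
  by_contra! hcon
  let M : Submonoid R := P.primeCompl ⊔ Submonoid.powers p
  have hdisj : Disjoint (I : Set R) M := by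
    rw [Set.disjoint_left]
    intro x hxI hxM
    obtain ⟨h, hh, _, ⟨k, rfl⟩, rfl⟩ := Submonoid.mem_sup.mp hxM
    -- Radicality enters here: `h * p ^ k ∈ I` puts a power of `h * p` in `I`.
    refine hcon h hh (hI ⟨k + 1, ?_⟩)
    have : (h * p) ^ (k + 1) = (h ^ k * p) * (h * p ^ k) := by ring
    rw [this]
    exact I.mul_mem_left _ hxI
  obtain ⟨Q, hQ, hIQ, hQM⟩ := Ideal.exists_le_prime_disjoint I M hdisj
  rw [Set.disjoint_left] at hQM
  have hQP : Q ≤ P := fun x hx => by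
    by_contra hxP
    exact hQM hx (Submonoid.mem_sup_left (show x ∈ P.primeCompl from hxP))
  exact hQM (hP.2 ⟨hQ, hIQ⟩ hQP hp) (Submonoid.mem_sup_right (Submonoid.mem_powers p))

theorem exists_forall_mul_mem_of_mem_minimalPrimes {I P : Ideal R} (hI : I.IsRadical)
    (hP : P ∈ I.minimalPrimes) {ι : Type*} [Fintype ι] (p : ι → R) (hp : ∀ k, p k ∈ P) :
    ∃ h ∉ P, ∀ k, h * p k ∈ I := by
  classical
  have hprime : P.IsPrime := hP.1.1
  choose h hh hhp using fun k => exists_mul_mem_of_mem_minimalPrimes hI hP (hp k)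
  refine ⟨∏ k, h k, ?_, fun k => ?_⟩
  · exact P.primeCompl.prod_mem fun k _ => hh k
  · rw [← Finset.prod_erase_mul _ _ (Finset.mem_univ k), mul_assoc]
    exact I.mul_mem_left _ (hhp k)

end MinimalPrimes

/-! ### Linear systems, dual numbers and derivations -/

/-- The Fredholm alternative for a finite linear system over a field. -/
theorem exists_solution_or_exists_obstruction {L ι κ : Type*} [Field L] [Fintype ι] [Fintype κ]
    (M : ι → κ → L) (b : ι → L) :
    (∃ v : κ → L, ∀ i, b i + ∑ k, M i k * v k = 0) ∨
      ∃ w : ι → L, (∀ k, ∑ i, w i * M i k = 0) ∧ ∑ i, w i * b i ≠ 0 := by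
  classical
  by_cases hb : b ∈ LinearMap.range (Matrix.mulVecLin (Matrix.of M))
  · obtain ⟨v, hv⟩ := hb
    refine Or.inl ⟨-v, fun i => ?_⟩
    rw [← hv]
    simp [Matrix.mulVec, dotProduct]
  -- A functional that vanishes on the column space but not at `b`; its coordinates are `w`.
  · obtain ⟨φ, hφ, hker⟩ := Submodule.exists_le_ker_of_notMem hb
    have hφsum : ∀ c : ι → L, φ c = ∑ i, φ (Pi.single i 1) * c i := fun c => by
      conv_lhs => rw [pi_eq_sum_univ' c, map_sum]
      refine Finset.sum_congr rfl fun i _ => ?_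
      rw [map_smul, smul_eq_mul, mul_comm]
    refine Or.inr ⟨fun i => φ (Pi.single i 1), fun k => ?_, by rwa [← hφsum]⟩
    rw [← hφsum fun i => M i k]
    refine hker ⟨Pi.single k 1, ?_⟩
    ext i
    simp

/-- The value of a polynomial at a tangent vector, as a point over the dual numbers. -/
theorem aeval_inl_add_inr {k σ L : Type*} [Field k] [Field L] [Algebra k L] [Fintype σ]
    (ξ v : σ → L) (p : MvPolynomial σ k) :
    aeval (fun w => (TrivSqZeroExt.inl (ξ w) + TrivSqZeroExt.inr (v w) : DualNumber L)) p =
      TrivSqZeroExt.inl (aeval ξ p) +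
        TrivSqZeroExt.inr (∑ w, aeval ξ (pderiv w p) * v w) := by
  classical
  induction p using MvPolynomial.induction_on with
  | C a =>
    simp only [algHom_C, pderiv_C, map_zero, zero_mul, Finset.sum_const_zero,
      TrivSqZeroExt.inr_zero, add_zero]
    rfl
  | add p q hp hq =>
    simp only [map_add, hp, hq, add_mul, Finset.sum_add_distrib, TrivSqZeroExt.inl_add,
      TrivSqZeroExt.inr_add]
    abel
  | mul_X p w hp =>
    rw [map_mul, hp, aeval_X]
    ext
    · simp
    · simp only [Derivation.leibniz, pderiv_X, map_add, map_mul, aeval_X, smul_eq_mul, add_mul,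
        Finset.sum_add_distrib, DualNumber.snd_mul, TrivSqZeroExt.fst_add, TrivSqZeroExt.snd_add,
        TrivSqZeroExt.fst_inl, TrivSqZeroExt.snd_inl, TrivSqZeroExt.fst_inr,
        TrivSqZeroExt.snd_inr, add_zero, zero_add]
      congr 1
      · rw [Finset.sum_eq_single w]
        · simp
        · intro b _ hb
          simp [hb.symm]
        · simp
      · rw [zero_mul, zero_add, Finset.sum_mul]
        exact Finset.sum_congr rfl fun _ _ => by ring

/-- A tangent vector at the generic point of an irreducible affine variety is given by a
derivation of its function field. -/
theorem exists_derivation_of_aeval_dualNumber_eq_zero {k σ A L : Type*} [Field k] [CommRing A]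
    [IsDomain A] [Algebra k A] [Field L] [Algebra k L] [Algebra A L] [IsScalarTower k A L]
    [IsFractionRing A L] [Fintype σ] (q : MvPolynomial σ k →ₐ[k] A) (hq : Function.Surjective q)
    (v : σ → L)
    (hv : ∀ p, q p = 0 → aeval (fun w => (TrivSqZeroExt.inl (algebraMap A L (q (X w))) +
      TrivSqZeroExt.inr (v w) : DualNumber L)) p = 0) :
    ∃ δ : Derivation k L L, ∀ w, δ (algebraMap A L (q (X w))) = v w := by
  let ξ : σ → L := fun w => algebraMap A L (q (X w))
  have hξ : ∀ p, aeval ξ p = algebraMap A L (q p) := fun p =>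
    DFunLike.congr_fun (show aeval ξ = (IsScalarTower.toAlgHom k A L).comp q by ext; simp [ξ]) p
  let Φ : MvPolynomial σ k →ₐ[k] DualNumber L :=
    aeval fun w => (TrivSqZeroExt.inl (ξ w) + TrivSqZeroExt.inr (v w) : DualNumber L)
  have hker : ∀ p ∈ RingHom.ker q, Φ p = 0 := hv
  let φ : A →ₐ[k] DualNumber L := (Ideal.Quotient.liftₐ (RingHom.ker q) Φ hker).comp
    (Ideal.quotientKerAlgEquivOfSurjective hq).symm.toAlgHom
  have hφ : ∀ p, φ (q p) = TrivSqZeroExt.inl (aeval ξ p) +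
        TrivSqZeroExt.inr (∑ w, aeval ξ (pderiv w p) * v w) := fun p => by
    have : (Ideal.quotientKerAlgEquivOfSurjective hq).symm (q p) =
        Ideal.Quotient.mk (RingHom.ker q) p := by
      rw [AlgEquiv.symm_apply_eq]
      rfl
    rw [← aeval_inl_add_inr]
    change Ideal.Quotient.liftₐ (RingHom.ker q) Φ hker
      ((Ideal.quotientKerAlgEquivOfSurjective hq).symm (q p)) = _
    rw [this]
    rfl
  have hfst : ∀ a, (φ a).fst = algebraMap A L a := fun a => by
    obtain ⟨p, rfl⟩ := hq a
    simp [hφ, hξ]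
  have hunit : ∀ y : nonZeroDivisors A, IsUnit (φ y) := fun y => by
    rw [TrivSqZeroExt.isUnit_iff_isUnit_fst, hfst]
    exact IsLocalization.map_units L y
  let ψ : L →ₐ[k] DualNumber L := IsLocalization.liftAlgHom (M := nonZeroDivisors A) hunit
  have hψ : ∀ a, ψ (algebraMap A L a) = φ a := fun a => IsLocalization.lift_eq hunit a
  have hψfst : ∀ x, (ψ x).fst = x := fun x => by
    have : (TrivSqZeroExt.fstHom k L L).comp ψ = AlgHom.id k L :=
      IsLocalization.algHom_ext (nonZeroDivisors A) (by
        ext a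
        change (ψ (algebraMap A L a)).fst = algebraMap A L a
        rw [hψ, hfst])
    exact DFunLike.congr_fun this x
  -- `ψ` is a multiplicative section of the first projection, so its second component satisfies the
  -- Leibniz rule.
  refine ⟨Derivation.mk' ((TrivSqZeroExt.sndHom L L).restrictScalars k ∘ₗ ψ.toLinearMap)
    fun a b => ?_, fun w => ?_⟩
  · simp [hψfst, mul_comm, add_comm]
  · classical
    change (ψ (algebraMap A L (q (X w)))).snd = v w
    rw [hψ, hφ]
    simp [pderiv_X, Pi.single_apply]

/-! ### The differential system and its prolongation -/

variable {n m s : ℕ} {f : Fin n → MvPolynomial (Fin n ⊕ Fin m) ℂ}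
  {g : Fin s → MvPolynomial (Fin n ⊕ Fin m) ℂ}

theorem eval_rename_inl (p : MvPolynomial (Fin n ⊕ Fin m) ℂ)
    (z : ZariskiSpace ((Fin n ⊕ Fin m) ⊕ Fin m)) :
    eval z (rename Sum.inl p) = eval (proj z) p :=
  eval_rename Sum.inl (z : (Fin n ⊕ Fin m) ⊕ Fin m → ℂ) p

theorem eval_tilde (h : MvPolynomial (Fin n ⊕ Fin m) ℂ)
    (z : ZariskiSpace ((Fin n ⊕ Fin m) ⊕ Fin m)) :
    eval z (tilde f h) = ∑ j, eval (proj z) (pderiv (Sum.inl j) h * f j) +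
      ∑ k, eval (proj z) (pderiv (Sum.inr k) h) * z (Sum.inr k) := by
  have hX : ∀ k, eval z (X (Sum.inr k)) = z (Sum.inr k) := fun k => eval_X (f := z) (Sum.inr k)
  simp only [tilde, map_add, map_sum, map_mul, eval_rename_inl, hX]

theorem proj_image_prolongation_subset :
    proj '' prolongation f g ⊆ variety (Set.range g) := by
  rintro _ ⟨z, hz, rfl⟩ _ ⟨i, rfl⟩
  rw [← eval_rename_inl]
  exact hz _ (Or.inl ⟨i, rfl⟩)

/-- If the linear combination of the `g̃ i` with coefficients `Λ i` does not involve `u̇` modulo the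
ideal of the `g i`, then it vanishes on the projection of the prolongation. -/
theorem eval_obstruction_eq_zero {Λ : Fin s → MvPolynomial (Fin n ⊕ Fin m) ℂ}
    (hΛ : ∀ k, ∑ i, Λ i * pderiv (Sum.inr k) (g i) ∈ Ideal.span (Set.range g))
    {a : ZariskiSpace (Fin n ⊕ Fin m)} (ha : a ∈ proj '' prolongation f g) :
    eval a (∑ i, Λ i * ∑ j, pderiv (Sum.inl j) (g i) * f j) = 0 := by
  have haV := proj_image_prolongation_subset ha
  rw [← variety_span] at haV
  obtain ⟨z, hz, rfl⟩ := ha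
  have hu : ∑ i, eval (proj z) (Λ i) *
      ∑ k, eval (proj z) (pderiv (Sum.inr k) (g i)) * z (Sum.inr k) = 0 := by
    simp only [Finset.mul_sum]
    rw [Finset.sum_comm]
    refine Finset.sum_eq_zero fun k _ => ?_
    have := haV _ (hΛ k)
    simp only [map_sum, map_mul] at this
    simp only [← mul_assoc, ← Finset.sum_mul, this, zero_mul]
  have htilde : ∑ i, eval (proj z) (Λ i) * eval z (tilde f (g i)) = 0 :=
    Finset.sum_eq_zero fun i _ => by rw [hz _ (Or.inr ⟨i, rfl⟩), mul_zero]
  simp only [eval_tilde, mul_add, Finset.sum_add_distrib, hu, add_zero] at htilde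
  simpa only [map_sum, map_mul] using htilde

/-- A solution of the linear system for `u̇` over the function field of a component yields a
solution of the differential system. -/
theorem hasSolution_of_linear_solution (hrad : (Ideal.span (Set.range g)).IsRadical)
    {P : Ideal (MvPolynomial (Fin n ⊕ Fin m) ℂ)} (hP : P ∈ (Ideal.span (Set.range g)).minimalPrimes)
    {L : Type} [Field L] [Algebra ℂ L] [Algebra (MvPolynomial (Fin n ⊕ Fin m) ℂ ⧸ P) L]
    [IsScalarTower ℂ (MvPolynomial (Fin n ⊕ Fin m) ℂ ⧸ P) L]
    [IsFractionRing (MvPolynomial (Fin n ⊕ Fin m) ℂ ⧸ P) L] {ξ : Fin n ⊕ Fin m → L}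
    (hξ : ∀ p, aeval ξ p = algebraMap (MvPolynomial (Fin n ⊕ Fin m) ℂ ⧸ P) L
      (Ideal.Quotient.mk P p)) {v : Fin m → L}
    (hv : ∀ i, aeval ξ (∑ j, pderiv (Sum.inl j) (g i) * f j) +
      ∑ k, aeval ξ (pderiv (Sum.inr k) (g i)) * v k = 0) : HasSolution f g := by
  have hprime : P.IsPrime := hP.1.1
  let V : Fin n ⊕ Fin m → L := Sum.elim (fun j => aeval ξ (f j)) v
  have hmem : ∀ p ∈ P, aeval ξ p = 0 := fun p hp => by
    rw [hξ, Ideal.Quotient.eq_zero_iff_mem.mpr hp, map_zero]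
  have hnotMem : ∀ p ∉ P, aeval ξ p ≠ 0 := fun p hp h => by
    rw [hξ, IsFractionRing.to_map_eq_zero_iff, Ideal.Quotient.eq_zero_iff_mem] at h
    exact hp h
  let Φ : MvPolynomial (Fin n ⊕ Fin m) ℂ →ₐ[ℂ] DualNumber L :=
    aeval fun w => (TrivSqZeroExt.inl (ξ w) + TrivSqZeroExt.inr (V w) : DualNumber L)
  have hΦg : ∀ p ∈ Ideal.span (Set.range g), Φ p = 0 := by
    change Ideal.span (Set.range g) ≤ RingHom.ker Φ
    rw [Ideal.span_le]
    rintro _ ⟨i, rfl⟩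
    change Φ (g i) = 0
    have hi := hv i
    simp only [map_sum, map_mul] at hi
    simp only [Φ, aeval_inl_add_inr, Fintype.sum_sum_type, V, Sum.elim_inl, Sum.elim_inr, hi,
      hmem _ (hP.1.2 (Ideal.subset_span ⟨i, rfl⟩)), TrivSqZeroExt.inl_zero,
      TrivSqZeroExt.inr_zero, add_zero]
  -- Some `h ∉ P` moves `p` into `(g)`, and `Φ h` is a unit because its first component is nonzero.
  have hΦP : ∀ p ∈ P, Φ p = 0 := fun p hp => by
    obtain ⟨h, hh, hhp⟩ := exists_mul_mem_of_mem_minimalPrimes hrad hP hp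
    have h0 := hΦg _ hhp
    rw [map_mul] at h0
    have hu : IsUnit (Φ h) := by
      rw [TrivSqZeroExt.isUnit_iff_isUnit_fst, aeval_inl_add_inr, TrivSqZeroExt.fst_add,
        TrivSqZeroExt.fst_inl, TrivSqZeroExt.fst_inr, add_zero]
      exact (hnotMem h hh).isUnit
    exact hu.mul_right_eq_zero.mp h0
  have hξX : ∀ w, algebraMap (MvPolynomial (Fin n ⊕ Fin m) ℂ ⧸ P) L
      (Ideal.Quotient.mkₐ ℂ P (X w)) = ξ w := fun w => by
    have := hξ (X w)
    rw [aeval_X] at this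
    exact this.symm
  obtain ⟨δ, hδ⟩ := exists_derivation_of_aeval_dualNumber_eq_zero (L := L)
    (Ideal.Quotient.mkₐ ℂ P) (Ideal.Quotient.mkₐ_surjective ℂ P) V (fun p hp => by
      simp only [hξX]
      exact hΦP p (Ideal.Quotient.eq_zero_iff_mem.mp hp))
  have helim : Sum.elim (fun j => ξ (Sum.inl j)) (fun k => ξ (Sum.inr k)) = ξ :=
    Sum.elim_comp_inl_inr ξ
  refine ⟨L, inferInstance, inferInstance, δ, fun j => ξ (Sum.inl j), fun k => ξ (Sum.inr k),
    fun j => ?_, fun i => ?_⟩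
  · rw [helim]
    exact (congrArg δ (hξX (Sum.inl j))).symm.trans (hδ (Sum.inl j))
  · rw [helim]
    exact hmem _ (hP.1.2 (Ideal.subset_span ⟨i, rfl⟩))

theorem not_component_subset_closure (hrad : (Ideal.span (Set.range g)).IsRadical)
    (hsol : ¬ HasSolution f g) {C : Set (ZariskiSpace (Fin n ⊕ Fin m))}
    (hC : IsIrreducibleComponentOf C (variety (Set.range g))) :
    ¬ C ⊆ closure (proj '' prolongation f g) := by
  intro hsub
  have hP := idealOf_mem_minimalPrimes hC
  set P := idealOf C
  have hprime : P.IsPrime := hP.1.1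
  let A := MvPolynomial (Fin n ⊕ Fin m) ℂ ⧸ P
  let L := FractionRing A
  let ξ : Fin n ⊕ Fin m → L := fun w => algebraMap A L (Ideal.Quotient.mk P (X w))
  have hξ : ∀ p, aeval ξ p = algebraMap A L (Ideal.Quotient.mk P p) := fun p =>
    DFunLike.congr_fun (show aeval ξ = (IsScalarTower.toAlgHom ℂ A L).comp
      (Ideal.Quotient.mkₐ ℂ P) by ext; simp [ξ]; rfl) p
  have hzero : ∀ p, aeval ξ p = 0 ↔ p ∈ P := fun p => by
    rw [hξ, IsFractionRing.to_map_eq_zero_iff, Ideal.Quotient.eq_zero_iff_mem]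
  rcases exists_solution_or_exists_obstruction
      (fun i k => aeval ξ (pderiv (Sum.inr k) (g i)))
      (fun i => aeval ξ (∑ j, pderiv (Sum.inl j) (g i) * f j)) with ⟨v, hv⟩ | ⟨w, hw, hwb⟩
  · exact hsol (hasSolution_of_linear_solution hrad hP hξ hv)
  · obtain ⟨d, hd⟩ := IsLocalization.exist_integer_multiples_of_finite (nonZeroDivisors A) w
    choose c hc using hd
    choose Λ hΛ using fun i => Ideal.Quotient.mk_surjective (c i)
    have hd0 : algebraMap A L d ≠ 0 := (IsLocalization.map_units L d).ne_zero
    have hΛw : ∀ i, aeval ξ (Λ i) = algebraMap A L d * w i := fun i => by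
      rw [hξ, hΛ, hc, Algebra.smul_def]
    -- The coefficients of `u̇` vanish only modulo `P`; the factor `h` moves them into `(g)`, so
    -- that they vanish on all of `V(g)`.
    obtain ⟨h, hhP, hh⟩ := exists_forall_mul_mem_of_mem_minimalPrimes hrad hP
      (fun k => ∑ i, Λ i * pderiv (Sum.inr k) (g i)) (fun k => by
        rw [← hzero]
        simp only [map_sum, map_mul, hΛw, mul_assoc]
        rw [← Finset.mul_sum, hw k, mul_zero])
    have hmem : ∑ i, (h * Λ i) * ∑ j, pderiv (Sum.inl j) (g i) * f j ∈ P := fun a ha =>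
      eval_eq_zero_of_mem_closure (fun b hb => eval_obstruction_eq_zero (fun k => by
        simpa only [mul_assoc, ← Finset.mul_sum] using hh k) hb) (hsub ha)
    rw [← hzero, map_sum] at hmem
    simp only [map_mul, hΛw, mul_assoc, ← Finset.mul_sum] at hmem
    exact mul_ne_zero (mt (hzero h).mp hhP) (mul_ne_zero hd0 hwb) hmem

end SemiexplicitDAE

end

theorem mainTheorem7 {n m s : ℕ} (f : Fin n → MvPolynomial (Fin n ⊕ Fin m) ℂ)
    (g : Fin s → MvPolynomial (Fin n ⊕ Fin m) ℂ)
    (hrad : (Ideal.span (Set.range g)).IsRadical)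
    (hsol : ¬ SemiexplicitDAE.HasSolution f g) :
    (∀ C : Set (SemiexplicitDAE.ZariskiSpace (Fin n ⊕ Fin m)),
      SemiexplicitDAE.IsIrreducibleComponentOf C (SemiexplicitDAE.variety (Set.range g)) →
      ¬ C ⊆ closure (SemiexplicitDAE.proj '' SemiexplicitDAE.prolongation f g)) ∧
    SemiexplicitDAE.proj '' SemiexplicitDAE.prolongation f g ⊆
      SemiexplicitDAE.variety (Set.range g) ∧
    ((SemiexplicitDAE.variety (Set.range g)).Nonempty →
      topologicalKrullDim ↥(closure (SemiexplicitDAE.proj '' SemiexplicitDAE.prolongation f g)) <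
        topologicalKrullDim ↥(SemiexplicitDAE.variety (Set.range g))) := by
  have hcomp : ∀ C : Set (SemiexplicitDAE.ZariskiSpace (Fin n ⊕ Fin m)),
      SemiexplicitDAE.IsIrreducibleComponentOf C (SemiexplicitDAE.variety (Set.range g)) →
      ¬ C ⊆ closure (SemiexplicitDAE.proj '' SemiexplicitDAE.prolongation f g) :=
    fun _ hC => SemiexplicitDAE.not_component_subset_closure hrad hsol hC
  refine ⟨hcomp, SemiexplicitDAE.proj_image_prolongation_subset, fun hne => ?_⟩
  exact SemiexplicitDAE.topologicalKrullDim_lt_of_forall_component isClosed_closure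
    (closure_minimal SemiexplicitDAE.proj_image_prolongation_subset
      (SemiexplicitDAE.isClosed_variety _)) hne
    ((topologicalKrullDim_subspace_le _ _).trans_lt
      SemiexplicitDAE.topologicalKrullDim_zariskiSpace_lt_top) hcomp
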